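/- Let $\Bbbk$ be an algebraically closed field and let $H$ be a finite dimensional semisimple Hopf algebra over $\Bbbk$, with comultiplication $\Delta(a)=a_{(1)}\otimes a_{(2)}$ (summation omitted), counit $\varepsilon$ and antipode $S$. Assume that $\Bbbk$ has characteristic $0$ or characteristic $p>\dim_{\Bbbk}(H)^{1/2}$. Let $\Lambda\in H$ be a left integral of $H$ ($h\Lambda=\varepsilon(h)\Lambda$ for all $h\in H$) and let $\lambda\in H^*$ be a right integral of $H^*$ ($\lambda(h_{(1)})h_{(2)}=\lambda(h)1$ for all $h\in H$) such that $\lambda(\Lambda)=1$. Let $\{V_i\}_{i\in I}$ be a complete set of pairwise non-isomorphic simple left $H$-modules, with characters $\chi_i$, let $e_i$ be the central primitive idempotent of $H$ that acts as the identity on $V_i$, and let $\chi_H$ be the character of the left regular representation of $H$. Let $g$ be the distinguished group-like element of $H$, i.e. the group-like element with $h_{(1)}\lambda(h_{(2)})=\lambda(h)g$ for all $h\in H$. Then the element $\mathbf{u}=S(\Lambda_{(2)})\Lambda_{(1)}$ is a unit of $H$ and has the following properties: 1. $\mathbf{u}=\chi_H(\Lambda_{(1)})S(\Lambda_{(2)})$.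 2. $\Lambda_{(1)}\mathbf{u}^{-1}S(\Lambda_{(2)})=1$. 3. $\lambda(e_i)=\dim_{\Bbbk}(V_i)\,\chi_i(\mathbf{u}^{-1})$ for all $i\in I$. 4. $\lambda(e_i)\neq 0$ for all $i\in I$, and $\mathbf{u}S(\mathbf{u})=S(\mathbf{u})\mathbf{u}=\varepsilon(\Lambda)\sum_{i\in I}\frac{\dim_{\Bbbk}(V_i)^2}{\lambda(e_i)}e_i$. 5. $S(\mathbf{u}^{-1})\mathbf{u}=\mathbf{u}S(\mathbf{u}^{-1})=g$. -/

import Mathlib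

open scoped TensorProduct

noncomputable section

namespace SemisimpleHopf

universe v w

/-- `Λ` is a left integral of `H`: `h Λ = ε(h) Λ` for all `h`. -/
def IsLeftIntegral (k : Type*) {H : Type*} [Field k] [Ring H] [HopfAlgebra k H] (Λ : H) : Prop :=
  ∀ h : H, h * Λ = Coalgebra.counit (R := k) h • Λ

/-- `lam` is a right integral of the dual algebra `H*` (with the convolution product
`(f f')(h) = f(h₍₁₎) f'(h₍₂₎)`, whose augmentation is `f ↦ f(1)`): `lam f = f(1) lam` for all
`f` in `H*`. -/
def IsRightIntegralDual {k H : Type*} [Field k] [Ring H] [HopfAlgebra k H]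
    (lam : Module.Dual k H) : Prop :=
  ∀ f : Module.Dual k H, WithConv.toConv lam * WithConv.toConv f = f 1 • WithConv.toConv lam

/-- `g` is the distinguished group-like element (modular element) of `H`: it is group-like, and
`f lam = f(g) lam` in `H*` for every right integral `lam` of `H*` and every `f` in `H*`. -/
structure IsDistinguishedGroupLike (k : Type*) {H : Type*} [Field k] [Ring H] [HopfAlgebra k H]
    (g : H) : Prop where
  isGroupLike : IsGroupLikeElem k g
  mul_integral : ∀ lam : Module.Dual k H, IsRightIntegralDual lam →
    ∀ f : Module.Dual k H, WithConv.toConv f * WithConv.toConv lam = f g • WithConv.toConv lam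

/-- The element `S(Λ₍₂₎) Λ₍₁₎`. -/
def uElt (k : Type*) {H : Type*} [Field k] [Ring H] [HopfAlgebra k H] (Λ : H) : H :=
  LinearMap.mul' k H (TensorProduct.map (HopfAlgebra.antipode k) LinearMap.id
    (TensorProduct.comm k H H (Coalgebra.comul (R := k) Λ)))

/-- The character `h ↦ tr(v ↦ h • v)` of a left `H`-module `V`. -/
def character (k H V : Type*) [Field k] [Ring H] [Algebra k H] [AddCommGroup V] [Module k V]
    [Module H V] [IsScalarTower k H V] : Module.Dual k H :=
  LinearMap.trace k V ∘ₗ (Algebra.lsmul k k V : H →ₐ[k] Module.End k V).toLinearMap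

/-- `e` is a central primitive idempotent of `H`: a nonzero central idempotent that has no central
idempotent strictly below it except `0`. -/
structure IsCentralPrimitiveIdempotent {H : Type*} [Ring H] (e : H) : Prop where
  mem_center : e ∈ Set.center H
  idem : IsIdempotentElem e
  ne_zero : e ≠ 0
  primitive : ∀ f : H, f ∈ Set.center H → IsIdempotentElem f → f * e = f → f = 0 ∨ f = e

/-- The family `V` is a complete set of simple left `H`-modules up to isomorphism, without
repetition. (Every simple `H`-module is a quotient of `H`, so modules in the universe of `H`
represent all of them.) -/
structure IsCompleteSimpleFamily (H : Type v) [Ring H] {I : Type*} (V : I → Type w)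
    [∀ i, AddCommGroup (V i)] [∀ i, Module H (V i)] : Prop where
  simple : ∀ i, IsSimpleModule H (V i)
  eq_of_equiv : ∀ i j, Nonempty (V i ≃ₗ[H] V j) → i = j
  complete : ∀ (W : Type v) [AddCommGroup W] [Module H W], IsSimpleModule H W →
    ∃ i, Nonempty (W ≃ₗ[H] V i)

end SemisimpleHopf

end

/-!
The integrals make `H` a Frobenius algebra: since `Λ₍₁₎ ⊗ h Λ₍₂₎ = S(h) Λ₍₁₎ ⊗ Λ₍₂₎` and
`λ(Λ₍₁₎) Λ₍₂₎ = 1`, the antipode is injective, hence bijective, and `x ⊗ y = Λ₍₁₎ ⊗ S(Λ₍₂₎)` is a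
Casimir element (`h x ⊗ y = x ⊗ y h`) with `λ(x) y = 1`. So `x` and `y` are dual bases for the form
`(a, b) ↦ λ(a b)` (`isFrobeniusSystem`), and expanding the traces of left and right multiplication
in them gives `χ_H(h) = λ(h u) = λ(u h)` for `u = y x = S(Λ₍₂₎) Λ₍₁₎`.

Consequently `u` is a unit as soon as the trace form is nondegenerate. If its radical, a two-sided
ideal, were nonzero, it would contain a simple left ideal `L` with an idempotent generator `f`, and
`χ_H(f) = dim L` would vanish in `k`. By Burnside's theorem `(dim L)² ≤ dim H`, so the hypothesis on
the characteristic excludes this. Now `λ = χ_H(· u⁻¹)`, and `Λ₍₁₎ u⁻¹ S(Λ₍₂₎) = 1` follows by pairing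
with `λ`. The block of `e_i` is `End V_i` (`IsCentralPrimitiveIdempotent.mul_eq_zero`), whence
`χ_H(e_i h) = dim(V_i) χ_i(h)` and the formula for `λ(e_i)`.

The Nakayama automorphism of `λ` is conjugation by `u`. As `Λ` is also a right integral, comparing
this with `Λ₍₁₎ h ⊗ S(Λ₍₂₎) = Λ₍₁₎ ⊗ S²(h) S(Λ₍₂₎)` shows that `S²` is conjugation by `u`, so
`S(u) u` is central. Its eigenvalue on `V_i` is found by evaluating `χ_i` on `S(u) = (S(u) u) u⁻¹`,
where `χ_i(S(u)) = ε(Λ) dim V_i` (`character_antipode_uElt`).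

Finally, right integrals of `H*` are unique up to scalars, so `f λ = f(g) λ` with
`g = Λ₍₁₎ λ(Λ₍₂₎)`; writing `λ` through `χ_H` and using `χ_H ∘ S = χ_H` identifies `g` with
`S(u⁻¹) u` (`sum_apply_smul_eq`).
-/

namespace SemisimpleHopf

/-! ### Simple modules over finite-dimensional algebras -/

section SimpleModules

variable {k A V : Type*} [Field k] [Ring A] [Algebra k A] [AddCommGroup V] [Module k V]
  [Module A V] [IsScalarTower k A V]

lemma finite_of_isSimpleModule (k A V : Type*) [Field k] [Ring A] [Algebra k A] [AddCommGroup V]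
    [Module k V] [Module A V] [IsScalarTower k A V] [Module.Finite k A] [IsSimpleModule A V] :
    Module.Finite k V := by
  have := IsSimpleModule.nontrivial A V
  obtain ⟨v, hv⟩ := exists_ne (0 : V)
  exact Module.Finite.of_surjective ((LinearMap.toSpanSingleton A V v).restrictScalars k)
    (IsSimpleModule.toSpanSingleton_surjective A hv)

/-- Burnside's theorem: by Schur's lemma every `k`-linear endomorphism commutes with `End_A V`,
so the density theorem applies to it. -/
lemma lsmul_surjective (k A V : Type*) [Field k] [Ring A] [Algebra k A] [AddCommGroup V]
    [Module k V] [Module A V] [IsScalarTower k A V] [IsAlgClosed k] [Module.Finite k V]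
    [IsSimpleModule A V] :
    Function.Surjective (Algebra.lsmul k k V : A →ₐ[k] Module.End k V) := by
  intro f
  have hsch := (IsSimpleModule.algebraMap_end_bijective_of_isAlgClosed (A := A) (V := V) k).2
  let f' : Module.End (Module.End A V) V :=
    { toFun := f
      map_add' := f.map_add
      map_smul' := fun φ v => by
        obtain ⟨c, rfl⟩ := hsch φ
        simp }
  obtain ⟨s, hs⟩ := Module.Finite.fg_top (R := k) (M := V)
  obtain ⟨r, hr⟩ := jacobson_density f' s
  refine ⟨r, LinearMap.ext_on hs fun v hv => ?_⟩
  exact (hr v hv).symm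

lemma finrank_sq_le (k A V : Type*) [Field k] [Ring A] [Algebra k A] [AddCommGroup V]
    [Module k V] [Module A V] [IsScalarTower k A V] [IsAlgClosed k] [Module.Finite k A]
    [IsSimpleModule A V] : Module.finrank k V ^ 2 ≤ Module.finrank k A := by
  have := finite_of_isSimpleModule k A V
  have h := LinearMap.finrank_le_finrank_of_surjective
    (f := (Algebra.lsmul k k V : A →ₐ[k] Module.End k V).toLinearMap) (lsmul_surjective k A V)
  rwa [Module.finrank_linearMap, ← sq] at h

/-- In positive characteristic `p`, the bound `(dim V)² ≤ dim A < p²` gives `0 < dim V < p`. -/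
lemma finrank_cast_ne_zero {A V : Type*} (k : Type*) [Field k] [Ring A] [Algebra k A]
    [AddCommGroup V] [Module k V] [Module A V] [IsScalarTower k A V] [IsAlgClosed k]
    [Module.Finite k A] [IsSimpleModule A V]
    (p : ℕ) [CharP k p] (hp : p = 0 ∨ Module.finrank k A < p ^ 2) :
    (Module.finrank k V : k) ≠ 0 := by
  have := finite_of_isSimpleModule k A V
  have := IsSimpleModule.nontrivial A V
  have hpos : 0 < Module.finrank k V := Module.finrank_pos
  rw [Ne, CharP.cast_eq_zero_iff k p]
  intro hdvd
  rcases hp with rfl | hp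
  · exact hpos.ne' (Nat.eq_zero_of_zero_dvd hdvd)
  · have h1 := Nat.le_of_dvd hpos hdvd
    have h2 := finrank_sq_le k A V
    have h3 := Nat.pow_le_pow_left h1 2
    omega

/-- A central element acts on a simple module by a scalar. -/
lemma exists_smul_eq_of_mem_center (k : Type*) {A : Type*} (V : Type*) [Field k] [Ring A]
    [Algebra k A] [AddCommGroup V]
    [Module k V] [Module A V] [IsScalarTower k A V] [IsAlgClosed k] [Module.Finite k A]
    [IsSimpleModule A V] {c : A} (hc : c ∈ Set.center A) : ∃ a : k, ∀ v : V, c • v = a • v := by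
  have := finite_of_isSimpleModule k A V
  let φ : Module.End A V :=
    { toFun := fun v => c • v
      map_add' := smul_add c
      map_smul' := fun h v => by
        simp only [smul_smul, RingHom.id_apply, (Set.mem_center_iff.1 hc).comm h |>.eq] }
  obtain ⟨a, ha⟩ := (IsSimpleModule.algebraMap_end_bijective_of_isAlgClosed (A := A) (V := V) k).2 φ
  exact ⟨a, fun v => (congr($ha v)).symm⟩

lemma character_mul_comm (a b : A) : character k A V (a * b) = character k A V (b * a) := by
  simp only [character, LinearMap.comp_apply, AlgHom.toLinearMap_apply, map_mul]
  exact LinearMap.trace_mul_comm k _ _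

lemma character_one [Module.Finite k V] : character k A V 1 = Module.finrank k V := by
  simp only [character, LinearMap.comp_apply, AlgHom.toLinearMap_apply, map_one]
  exact LinearMap.trace_one k V

lemma character_mul_of_smul_eq {c : A} {a : k} (hc : ∀ v : V, c • v = a • v) (h : A) :
    character k A V (c * h) = a * character k A V h := by
  have : (Algebra.lsmul k k V : A →ₐ[k] Module.End k V) (c * h) =
      a • (Algebra.lsmul k k V : A →ₐ[k] Module.End k V) h := by
    ext v
    simp [hc]
  simp [character, this]

/-- As a module over itself, `End V` is the direct sum of its columns, each a copy of `V`. -/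
lemma trace_mulLeft_end (k : Type*) {V : Type*} [Field k] [AddCommGroup V] [Module k V]
    [Module.Finite k V] (f : Module.End k V) :
    LinearMap.trace k _ (LinearMap.mulLeft k f) = Module.finrank k V * LinearMap.trace k V f := by
  let b := Module.finBasis k V
  -- `ev i` reads off the `i`-th column of an endomorphism, and `col i` has `i`-th column `v`
  -- and all other columns zero.
  let ev : Fin (Module.finrank k V) → Module.End k V →ₗ[k] V := fun i => LinearMap.applyₗ (b i)
  let col : Fin (Module.finrank k V) → V →ₗ[k] Module.End k V :=
    fun i => LinearMap.smulRightₗ (b.coord i)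
  have hid : ∀ i, ev i ∘ₗ col i = LinearMap.id := fun i => by ext v; simp [ev, col]
  have hsum : LinearMap.mulLeft k f = ∑ i, col i ∘ₗ (f ∘ₗ ev i) := by
    refine LinearMap.ext fun g => b.ext fun j => ?_
    simp [ev, col, Finsupp.single_apply]
  have htr : ∀ i, LinearMap.trace k _ (col i ∘ₗ (f ∘ₗ ev i)) = LinearMap.trace k V f := fun i => by
    rw [LinearMap.trace_comp_comm', LinearMap.comp_assoc, hid, LinearMap.comp_id]
  rw [hsum, map_sum]
  simp [htr]

end SimpleModules

/-! ### Ideals and blocks of semisimple rings -/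

section SemisimpleRings

variable {A : Type*} [Ring A] [IsSemisimpleRing A]

/-- Every two-sided ideal of a semisimple ring is generated by a central idempotent. -/
lemma exists_central_idempotent (J : Ideal A) (hJ : ∀ x ∈ J, ∀ a : A, x * a ∈ J) :
    ∃ f ∈ J, f ∈ Set.center A ∧ IsIdempotentElem f ∧ ∀ x ∈ J, x * f = x := by
  obtain ⟨f, hf, hJf⟩ := IsSemisimpleRing.ideal_eq_span_idempotent J
  have hfJ : f ∈ J := hJf ▸ Ideal.mem_span_singleton_self f
  have hr : ∀ x ∈ J, x * f = x := fun x hx => by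
    rw [hJf] at hx
    obtain ⟨a, rfl⟩ := Ideal.mem_span_singleton'.1 hx
    rw [mul_assoc, hf]
  -- The elements of `J` killed by `f` form a left ideal of square zero, which is therefore zero.
  let K : Ideal A :=
    { carrier := {x | x ∈ J ∧ ∀ z ∈ J, z * x = 0}
      add_mem' := fun ha hb => ⟨J.add_mem ha.1 hb.1, fun z hz => by
        rw [mul_add, ha.2 z hz, hb.2 z hz, add_zero]⟩
      zero_mem' := ⟨J.zero_mem, fun z _ => mul_zero z⟩
      smul_mem' := fun c x hx => ⟨J.mul_mem_left c hx.1, fun z hz => by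
        rw [smul_eq_mul, ← mul_assoc, hx.2 _ (hJ z hz c)]⟩ }
  have hK : ∀ x ∈ K, x = 0 := by
    obtain ⟨q, hq, hKq⟩ := IsSemisimpleRing.ideal_eq_span_idempotent K
    have hqK : q ∈ K := hKq ▸ Ideal.mem_span_singleton_self q
    have : q = 0 := by rw [← hq.eq]; exact hqK.2 q hqK.1
    intro x hx
    rw [hKq, this] at hx
    simpa using hx
  have hl : ∀ x ∈ J, f * x = x := fun x hx => by
    refine sub_eq_zero.1 (hK _ ⟨J.sub_mem (J.mul_mem_left f hx) hx, fun z hz => ?_⟩)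
    rw [mul_sub, ← mul_assoc, hr z hz, sub_self]
  refine ⟨f, hfJ, Semigroup.mem_center_iff.2 fun a => ?_, hf, hr⟩
  rw [← hl (a * f) (J.mul_mem_left a hfJ), ← mul_assoc, hr _ (hJ f hfJ a)]

/-- An element that acts as zero on all members of a complete family of simple modules is zero. -/
lemma eq_zero_of_smul_eq_zero {I : Type*} {V : I → Type*} [∀ i, AddCommGroup (V i)]
    [∀ i, Module A (V i)] (hV : IsCompleteSimpleFamily A V) {h : A}
    (h0 : ∀ i, ∀ v : V i, h • v = 0) : h = 0 := by
  have hL : ∀ L : Submodule A A, IsSimpleModule A L → ∀ x ∈ L, h * x = 0 := by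
    intro L hL x hx
    obtain ⟨i, ⟨φ⟩⟩ := hV.complete L hL
    have : h • (⟨x, hx⟩ : L) = 0 := φ.injective (by rw [map_smul, h0, map_zero])
    simpa using congr_arg Subtype.val this
  have h1 : (1 : A) ∈ sSup {m : Submodule A A | IsSimpleModule A m} := by
    rw [IsSemisimpleModule.sSup_simples_eq_top]; trivial
  have : h * 1 = 0 := by
    rw [sSup_eq_iSup'] at h1
    refine Submodule.iSup_induction _ (motive := fun x => h * x = 0) h1
      (fun L x hx => hL L.1 L.2 x hx) (mul_zero h) fun x y hx hy => ?_
    rw [mul_add, hx, hy, add_zero]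
  rwa [mul_one] at this

/-- The block `e A` of a central primitive idempotent acts faithfully on a module where `e` acts
as the identity. -/
lemma IsCentralPrimitiveIdempotent.mul_eq_zero {e : A} (he : IsCentralPrimitiveIdempotent e)
    {V : Type*} [AddCommGroup V] [Module A V] [Nontrivial V] (heV : ∀ v : V, e • v = v) {h : A}
    (h0 : ∀ v : V, h • v = 0) : e * h = 0 := by
  have hcomm : ∀ a, e * a = a * e := fun a => (Set.mem_center_iff.1 he.mem_center).comm a
  let J : Ideal A :=
    { carrier := {x | e * x = x ∧ ∀ v : V, x • v = 0}
      add_mem' := fun ha hb => ⟨by rw [mul_add, ha.1, hb.1], fun v => by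
        rw [add_smul, ha.2, hb.2, add_zero]⟩
      zero_mem' := ⟨mul_zero e, zero_smul A⟩
      smul_mem' := fun c x hx => ⟨by
        rw [smul_eq_mul, ← mul_assoc, hcomm, mul_assoc, hx.1], fun v => by
        rw [smul_eq_mul, mul_smul, hx.2, smul_zero]⟩ }
  obtain ⟨f, hfJ, hfc, hf, hfr⟩ := exists_central_idempotent J fun x hx a =>
    ⟨by rw [← mul_assoc, hx.1], fun v => by rw [mul_smul, hx.2]⟩
  have hehJ : e * h ∈ J := ⟨by rw [← mul_assoc, he.idem.eq], fun v => by
    rw [mul_smul, h0, smul_zero]⟩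
  rcases he.primitive f hfc hf (by rw [← hcomm, hfJ.1]) with h | h
  · rw [← hfr _ hehJ, h, mul_zero]
  · obtain ⟨v, hv⟩ := exists_ne (0 : V)
    exact absurd (by rw [← heV v, ← h, hfJ.2]) hv

/-- A central primitive idempotent acting as the identity on a simple module `V` acts as zero on
every other simple module: a simple left ideal in its block maps nontrivially to `V`. -/
lemma IsCentralPrimitiveIdempotent.smul_eq_zero {e : A} (he : IsCentralPrimitiveIdempotent e)
    {V W : Type*} [AddCommGroup V] [Module A V] [IsSimpleModule A V] [AddCommGroup W] [Module A W]
    [IsSimpleModule A W] (heV : ∀ v : V, e • v = v) (hVW : IsEmpty (V ≃ₗ[A] W)) (w : W) :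
    e • w = 0 := by
  have hcomm : ∀ a, e * a = a * e := fun a => (Set.mem_center_iff.1 he.mem_center).comm a
  have := IsSimpleModule.nontrivial A V
  obtain ⟨L, ⟨φ⟩⟩ := IsSemisimpleRing.exists_linearEquiv_ideal_of_isSimpleModule A W
  have : IsSimpleModule A L := IsSimpleModule.congr φ.symm
  have hL : ∀ x ∈ L, ∀ v : V, x • v = 0 := by
    intro x hx v
    let ψ : L →ₗ[A] V := (LinearMap.toSpanSingleton A V v).comp L.subtype
    have hψ : ψ = 0 := by
      by_contra hψ
      exact hVW.false (φ.trans (LinearEquiv.ofBijective ψ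
        (LinearMap.bijective_of_ne_zero hψ))).symm
    exact congr($hψ ⟨x, hx⟩)
  refine φ.injective ?_
  rw [map_smul, map_zero]
  exact Subtype.ext (he.mul_eq_zero heV (hL _ (φ w).2))

end SemisimpleRings

/-! ### The regular character on a block -/

section BlockCharacter

variable {k A V : Type*} [Field k] [IsAlgClosed k] [Ring A] [Algebra k A] [Module.Finite k A]
  [IsSemisimpleRing A] [AddCommGroup V] [Module k V] [Module A V] [IsScalarTower k A V]
  [IsSimpleModule A V]

/-- The block of `V` is isomorphic to `End V`, on which left multiplication by `f` has trace
`dim V * tr f`. -/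
lemma IsCentralPrimitiveIdempotent.character_mul {e : A} (he : IsCentralPrimitiveIdempotent e)
    (heV : ∀ v : V, e • v = v) (h : A) :
    character k A A (e * h) = Module.finrank k V * character k A V h := by
  have := finite_of_isSimpleModule k A V
  have := IsSimpleModule.nontrivial A V
  have hcomm : ∀ a, e * a = a * e := fun a => (Set.mem_center_iff.1 he.mem_center).comm a
  let ρ := (Algebra.lsmul k k V : A →ₐ[k] Module.End k V)
  obtain ⟨s, hs⟩ := ρ.toLinearMap.exists_rightInverse_of_surjective
    (LinearMap.range_eq_top.2 (lsmul_surjective k A V))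
  have hs' : ∀ f, ρ (s f) = f := fun f => congr($hs f)
  have hρe : ρ e = 1 := LinearMap.ext heV
  -- `σ` is the inverse of the isomorphism from the block `e A` to `End V`.
  let σ : Module.End k V →ₗ[k] A := LinearMap.mulLeft k e ∘ₗ s
  have hσρ : ∀ x, σ (ρ x) = e * x := fun x => by
    rw [← sub_eq_zero]
    change e * s (ρ x) - e * x = 0
    rw [← mul_sub]
    refine he.mul_eq_zero heV fun v => ?_
    change ρ (s (ρ x) - x) v = 0
    rw [map_sub, hs', sub_self, LinearMap.zero_apply]
  have hρσ : ρ.toLinearMap ∘ₗ σ = LinearMap.id := LinearMap.ext fun f => by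
    change ρ (e * s f) = f
    rw [map_mul, hρe, one_mul, hs']
  have h1 : (Algebra.lsmul k k A : A →ₐ[k] Module.End k A) (e * h) =
      σ ∘ₗ (LinearMap.mulLeft k (ρ h) ∘ₗ ρ.toLinearMap) := LinearMap.ext fun x => by
    change e * h * x = σ (ρ h * ρ x)
    rw [← map_mul, hσρ, mul_assoc]
  calc character k A A (e * h)
      = LinearMap.trace k A (σ ∘ₗ (LinearMap.mulLeft k (ρ h) ∘ₗ ρ.toLinearMap)) :=
        congr_arg _ h1
    _ = LinearMap.trace k _ (LinearMap.mulLeft k (ρ h)) := by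
        rw [LinearMap.trace_comp_comm', LinearMap.comp_assoc, hρσ, LinearMap.comp_id]
    _ = _ := trace_mulLeft_end k _

end BlockCharacter

/-! ### Dual bases of a Frobenius algebra -/

section FrobeniusSystems

variable {k A ι : Type*} [Field k] [Ring A] [Algebra k A]

/-- A linear form `lam` on an algebra together with a finite family of pairs `(x i, y i)` such that
`∑ x i ⊗ y i` is a Casimir element, normalized by `∑ lam (x i) y i = 1`. Such data turn the algebra
into a Frobenius algebra, with `x` and `y` dual to each other for the form `(a, b) ↦ lam (a b)`. -/
structure IsFrobeniusSystem (lam : Module.Dual k A) (s : Finset ι) (x y : ι → A) : Prop where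
  casimir : ∀ h, ∑ i ∈ s, (h * x i) ⊗ₜ[k] y i = ∑ i ∈ s, x i ⊗ₜ[k] (y i * h)
  normalized : ∑ i ∈ s, lam (x i) • y i = 1

namespace IsFrobeniusSystem

variable {lam : Module.Dual k A} {s : Finset ι} {x y : ι → A}

lemma casimir_apply (hF : IsFrobeniusSystem lam s x y) {M : Type*} [AddCommGroup M] [Module k M]
    (B : A →ₗ[k] A →ₗ[k] M) (h : A) :
    ∑ i ∈ s, B (h * x i) (y i) = ∑ i ∈ s, B (x i) (y i * h) := by
  simpa using congr(TensorProduct.lift B $(hF.casimir h))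

/-- The dual basis expansion; `sum_smul_left` is the mirror image. -/
lemma sum_smul_right (hF : IsFrobeniusSystem lam s x y) (h : A) :
    ∑ i ∈ s, lam (h * x i) • y i = h := by
  have := hF.casimir_apply ((LinearMap.lsmul k A).comp lam) h
  simp only [LinearMap.comp_apply, LinearMap.lsmul_apply] at this
  rw [this]
  simp_rw [← smul_mul_assoc]
  rw [← Finset.sum_mul, hF.normalized, one_mul]

lemma ext_left (hF : IsFrobeniusSystem lam s x y) {h : A} (h0 : ∀ a, lam (h * a) = 0) : h = 0 := by
  rw [← hF.sum_smul_right h]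
  exact Finset.sum_eq_zero fun i _ => by rw [h0, zero_smul]

/-- By finite-dimensionality nondegeneracy in the other variable (`ext_left`) makes every linear form
equal to some `lam (a * ·)`. -/
lemma ext_right [Module.Finite k A] (hF : IsFrobeniusSystem lam s x y) {h : A}
    (h0 : ∀ a, lam (a * h) = 0) : h = 0 := by
  let B : A →ₗ[k] Module.Dual k A := (LinearMap.mul k A).compr₂ lam
  have hinj : Function.Injective B := by
    rw [injective_iff_map_eq_zero]
    exact fun a ha => hF.ext_left fun b => congr($ha b)
  have hsurj : Function.Surjective B :=
    (LinearMap.injective_iff_surjective_of_finrank_eq_finrank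
      (Subspace.dual_finrank_eq (K := k) (V := A)).symm).1 hinj
  rw [← Module.forall_dual_apply_eq_zero_iff k]
  intro φ
  obtain ⟨a, rfl⟩ := hsurj φ
  exact h0 a

lemma sum_smul_left [Module.Finite k A] (hF : IsFrobeniusSystem lam s x y) (h : A) :
    ∑ i ∈ s, lam (y i * h) • x i = h := by
  rw [← sub_eq_zero]
  refine hF.ext_right fun a => ?_
  have := congr(lam ($(hF.sum_smul_right a) * h))
  simp only [Finset.sum_mul, smul_mul_assoc, map_sum, map_smul, smul_eq_mul] at this
  simp only [mul_sub, Finset.mul_sum, mul_smul_comm, map_sub, map_sum, map_smul, smul_eq_mul,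
    ← this, sub_eq_zero]
  exact Finset.sum_congr rfl fun i _ => mul_comm _ _

lemma trace_eq_sum [Module.Finite k A] (hF : IsFrobeniusSystem lam s x y) (T : Module.End k A) :
    LinearMap.trace k A T = ∑ i ∈ s, lam (T (y i) * x i) := by
  have : T = ∑ i ∈ s, (lam ∘ₗ LinearMap.mulRight k (x i)).smulRight (T (y i)) :=
    LinearMap.ext fun h => by
      conv_lhs => rw [← hF.sum_smul_right h]
      simp [map_sum]
  conv_lhs => rw [this]
  simp

lemma trace_eq_sum' [Module.Finite k A] (hF : IsFrobeniusSystem lam s x y) (T : Module.End k A) :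
    LinearMap.trace k A T = ∑ i ∈ s, lam (y i * T (x i)) := by
  have : T = ∑ i ∈ s, (lam ∘ₗ LinearMap.mulLeft k (y i)).smulRight (T (x i)) :=
    LinearMap.ext fun h => by
      conv_lhs => rw [← hF.sum_smul_left h]
      simp [map_sum]
  conv_lhs => rw [this]
  simp

/-- Left and right multiplication by `h` have the same trace, as both expansions lead to this sum. -/
lemma character_eq_sum [Module.Finite k A] (hF : IsFrobeniusSystem lam s x y) (h : A) :
    character k A A h = ∑ i ∈ s, lam (y i * h * x i) := by
  refine (hF.trace_eq_sum' (LinearMap.mulLeft k h)).trans ?_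
  simp [mul_assoc]

lemma character_eq_trace_mulRight [Module.Finite k A] (hF : IsFrobeniusSystem lam s x y) (h : A) :
    character k A A h = LinearMap.trace k A (LinearMap.mulRight k h) := by
  rw [hF.character_eq_sum, hF.trace_eq_sum]
  simp

lemma character_eq_mul_right [Module.Finite k A] (hF : IsFrobeniusSystem lam s x y) (h : A) :
    character k A A h = lam (h * ∑ i ∈ s, y i * x i) := by
  refine (hF.trace_eq_sum (LinearMap.mulLeft k h)).trans ?_
  simp [Finset.mul_sum, mul_assoc]

lemma character_eq_mul_left [Module.Finite k A] (hF : IsFrobeniusSystem lam s x y) (h : A) :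
    character k A A h = lam ((∑ i ∈ s, y i * x i) * h) := by
  rw [hF.character_eq_trace_mulRight, hF.trace_eq_sum']
  simp [Finset.sum_mul, mul_assoc]

lemma sum_character_smul [Module.Finite k A] (hF : IsFrobeniusSystem lam s x y) :
    ∑ i ∈ s, character k A A (x i) • y i = ∑ i ∈ s, y i * x i := by
  simp_rw [hF.character_eq_mul_left]
  exact hF.sum_smul_right _

lemma sum_mul_mul_central (hF : IsFrobeniusSystem lam s x y) (a h : A) :
    h * ∑ i ∈ s, x i * a * y i = (∑ i ∈ s, x i * a * y i) * h := by
  have := hF.casimir_apply ((LinearMap.mul k A).comp (LinearMap.mulRight k a)) h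
  simp only [LinearMap.comp_apply, LinearMap.mulRight_apply, LinearMap.mul_apply'] at this
  rw [Finset.mul_sum, Finset.sum_mul]
  simpa only [mul_assoc] using this

variable [Module.Finite k A]

/-- In a semisimple algebra whose simple modules have dimension nonzero in `k`, the trace form is
nondegenerate: a nonzero radical would contain a simple left ideal `L`, and the trace of right
multiplication by an idempotent generator of `L` is `dim L`. -/
lemma eq_zero_of_character_mul_eq_zero [IsAlgClosed k] [IsSemisimpleRing A]
    (hF : IsFrobeniusSystem lam s x y) (p : ℕ) [CharP k p]
    (hp : p = 0 ∨ Module.finrank k A < p ^ 2) {h : A}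
    (h0 : ∀ a, character k A A (h * a) = 0) : h = 0 := by
  let J : Ideal A :=
    { carrier := {h | ∀ a, character k A A (h * a) = 0}
      add_mem' := fun ha hb a => by rw [add_mul, map_add, ha, hb, add_zero]
      zero_mem' := fun a => by rw [zero_mul, map_zero]
      smul_mem' := fun c h hh a => by
        rw [smul_eq_mul, mul_assoc, character_mul_comm, mul_assoc, hh] }
  rcases IsSemisimpleModule.eq_bot_or_exists_simple_le J with hJ | ⟨L, hLJ, hL⟩
  · exact (Submodule.mem_bot A).1 (hJ ▸ (show h ∈ J from h0))
  · exfalso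
    obtain ⟨f, hf, hLf⟩ := IsSemisimpleRing.ideal_eq_span_idempotent L
    have hfL : f ∈ L := hLf ▸ Ideal.mem_span_singleton_self f
    have h1 := hLJ hfL 1
    rw [mul_one, hF.character_eq_trace_mulRight] at h1
    have hproj : LinearMap.IsProj (L.restrictScalars k) (LinearMap.mulRight k f) :=
      ⟨fun a => L.smul_mem a hfL, fun a ha => by
        obtain ⟨b, rfl⟩ := Ideal.mem_span_singleton'.1 (hLf ▸ ha : a ∈ Ideal.span {f})
        rw [LinearMap.mulRight_apply, mul_assoc, hf.eq]⟩
    rw [hproj.trace] at h1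
    exact finrank_cast_ne_zero (V := L) k p hp h1

lemma isUnit_sum_mul [IsAlgClosed k] [IsSemisimpleRing A]
    (hF : IsFrobeniusSystem lam s x y) (p : ℕ) [CharP k p]
    (hp : p = 0 ∨ Module.finrank k A < p ^ 2) : IsUnit (∑ i ∈ s, y i * x i) := by
  have : IsArtinianRing A := IsArtinianRing.of_finite k A
  refine IsArtinianRing.isUnit_iff_isRegular.2
    ⟨isLeftRegular_iff_right_eq_zero_of_mul.2 fun a ha => ?_,
      isRightRegular_iff_left_eq_zero_of_mul.2 fun a ha => ?_⟩
  · refine hF.eq_zero_of_character_mul_eq_zero p hp fun b => ?_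
    rw [hF.character_eq_mul_left, ← mul_assoc, ha, zero_mul, map_zero]
  · refine hF.eq_zero_of_character_mul_eq_zero p hp fun b => ?_
    rw [character_mul_comm, hF.character_eq_mul_right, mul_assoc, ha, mul_zero, map_zero]

section Unit

variable {u : Aˣ}

lemma apply_eq_character_mul_inv (hF : IsFrobeniusSystem lam s x y)
    (hu : (u : A) = ∑ i ∈ s, y i * x i) (h : A) :
    lam h = character k A A (h * ((u⁻¹ : Aˣ) : A)) := by
  rw [hF.character_eq_mul_right, ← hu, mul_assoc, Units.inv_mul, mul_one]

/-- The Nakayama automorphism of the form is conjugation by `u`. -/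
lemma apply_mul_comm (hF : IsFrobeniusSystem lam s x y)
    (hu : (u : A) = ∑ i ∈ s, y i * x i) (a b : A) :
    lam (a * b) = lam (u * b * ((u⁻¹ : Aˣ) : A) * a) := by
  rw [mul_assoc, mul_assoc, hu, ← hF.character_eq_mul_left, hF.apply_eq_character_mul_inv hu,
    mul_assoc, character_mul_comm, mul_assoc]

/-- The left-hand side is central by the Casimir property; pairing it with an arbitrary `h` under
`lam` gives `lam h`. -/
lemma sum_mul_inv_mul (hF : IsFrobeniusSystem lam s x y)
    (hu : (u : A) = ∑ i ∈ s, y i * x i) :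
    ∑ i ∈ s, x i * ((u⁻¹ : Aˣ) : A) * y i = 1 := by
  rw [← sub_eq_zero]
  refine hF.ext_left fun h => ?_
  rw [sub_mul, one_mul, map_sub, sub_eq_zero, ← hF.sum_mul_mul_central, hF.apply_mul_comm hu]
  have : ∀ i, lam (u * (x i * ((u⁻¹ : Aˣ) : A) * y i) * ((u⁻¹ : Aˣ) : A) * h) =
      lam (y i * (((u⁻¹ : Aˣ) : A) * h) * x i) := fun i => by
    rw [hF.apply_mul_comm hu (y i * _) (x i)]
    congr 1
    simp only [mul_assoc]
  simp only [Finset.mul_sum, Finset.sum_mul, map_sum, this]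
  rw [← hF.character_eq_sum, hF.character_eq_mul_left, ← hu, Units.mul_inv_cancel_left]

end Unit

end IsFrobeniusSystem

end FrobeniusSystems

/-! ### Integrals of a Hopf algebra -/

section HopfAlgebras

open HopfAlgebra Coalgebra

variable {k H : Type*} [Field k] [Ring H] [HopfAlgebra k H]

/-- `S(h₍₁₎) h₍₂₎ ⊗ h₍₃₎ = 1 ⊗ h`. -/
lemma sum_antipode_tmul_one_mul_comul (h : H) :
    ∑ j ∈ (ℛ k h).index, (antipode k ((ℛ k h).left j) ⊗ₜ[k] (1 : H)) * comul ((ℛ k h).right j) =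
      1 ⊗ₜ[k] h := by
  let Ψ : H ⊗[k] (H ⊗[k] H) →ₗ[k] H ⊗[k] H :=
    (LinearMap.mul' k H ∘ₗ (antipode k).rTensor H).rTensor H ∘ₗ
      (TensorProduct.assoc k H H H).symm.toLinearMap
  have hΨ : ∀ (a : H) (t : H ⊗[k] H), Ψ (a ⊗ₜ t) = (antipode k a ⊗ₜ[k] (1 : H)) * t := by
    intro a t
    induction t with
    | zero => simp
    | add s t hs ht => rw [TensorProduct.tmul_add, map_add, hs, ht, mul_add]
    | tmul b c => simp [Ψ]
  have h1 : Ψ (comul.lTensor H (comul h)) = (1 : H) ⊗ₜ[k] h := by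
    simp only [Ψ, LinearMap.comp_apply, LinearEquiv.coe_coe, coassoc_symm_apply]
    rw [← LinearMap.comp_apply, ← LinearMap.rTensor_comp, LinearMap.comp_assoc,
      mul_antipode_rTensor_comul, LinearMap.rTensor_comp, LinearMap.comp_apply,
      rTensor_counit_comul]
    simp
  conv_lhs at h1 => rw [← (ℛ k h).eq]
  simpa [hΨ] using h1

/-- `h₍₁₎ ⊗ h₍₂₎ S(h₍₃₎) = h ⊗ 1`. -/
lemma sum_comul_mul_one_tmul_antipode (h : H) :
    ∑ j ∈ (ℛ k h).index, comul ((ℛ k h).left j) * ((1 : H) ⊗ₜ[k] antipode k ((ℛ k h).right j)) =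
      h ⊗ₜ[k] 1 := by
  let Ψ : (H ⊗[k] H) ⊗[k] H →ₗ[k] H ⊗[k] H :=
    (LinearMap.mul' k H ∘ₗ (antipode k).lTensor H).lTensor H ∘ₗ
      (TensorProduct.assoc k H H H).toLinearMap
  have hΨ : ∀ (t : H ⊗[k] H) (c : H), Ψ (t ⊗ₜ c) = t * ((1 : H) ⊗ₜ[k] antipode k c) := by
    intro t c
    induction t with
    | zero => simp
    | add s t hs ht => rw [TensorProduct.add_tmul, map_add, hs, ht, add_mul]
    | tmul a b => simp [Ψ]
  have h1 : Ψ (comul.rTensor H (comul h)) = h ⊗ₜ[k] (1 : H) := by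
    simp only [Ψ, LinearMap.comp_apply, LinearEquiv.coe_coe, coassoc_apply]
    rw [← LinearMap.comp_apply, ← LinearMap.lTensor_comp, LinearMap.comp_assoc,
      mul_antipode_lTensor_comul, LinearMap.lTensor_comp, LinearMap.comp_apply,
      lTensor_counit_comul]
    simp
  conv_lhs at h1 => rw [← (ℛ k h).eq]
  simpa [hΨ] using h1

variable {Λ : H} {lam : Module.Dual k H}

/-- `Λ₍₁₎ ⊗ h Λ₍₂₎ = S(h) Λ₍₁₎ ⊗ Λ₍₂₎`. -/
lemma IsLeftIntegral.one_tmul_mul_comul (hΛ : IsLeftIntegral k Λ) (h : H) :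
    ((1 : H) ⊗ₜ[k] h) * comul Λ = (antipode k h ⊗ₜ[k] (1 : H)) * comul Λ := by
  rw [← sum_antipode_tmul_one_mul_comul, Finset.sum_mul]
  simp_rw [mul_assoc, ← Bialgebra.comul_mul, hΛ _, map_smul, mul_smul_comm, ← smul_mul_assoc,
    ← Finset.sum_mul]
  congr 1
  have h2 := congr(TensorProduct.map (antipode k) (Algebra.linearMap k H)
    $(sum_tmul_counit_eq (ℛ k h)))
  simp only [map_sum, TensorProduct.map_tmul, Algebra.linearMap_apply,
    Algebra.algebraMap_eq_smul_one, one_smul] at h2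
  rw [← h2]
  simp only [TensorProduct.tmul_smul]

/-- `Λ₍₁₎ h ⊗ Λ₍₂₎ = Λ₍₁₎ ⊗ Λ₍₂₎ S(h)` for a right integral `Λ`. -/
lemma comul_mul_tmul_one (hΛ : ∀ h : H, Λ * h = counit (R := k) h • Λ) (h : H) :
    comul Λ * (h ⊗ₜ[k] (1 : H)) = comul Λ * ((1 : H) ⊗ₜ[k] antipode k h) := by
  rw [← sum_comul_mul_one_tmul_antipode, Finset.mul_sum]
  simp_rw [← mul_assoc, ← Bialgebra.comul_mul, hΛ _, map_smul, smul_mul_assoc, ← mul_smul_comm,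
    ← Finset.mul_sum]
  congr 1
  have h2 := congr(TensorProduct.map (Algebra.linearMap k H) (antipode k)
    $(sum_counit_tmul_eq (ℛ k h)))
  simp only [map_sum, TensorProduct.map_tmul, Algebra.linearMap_apply,
    Algebra.algebraMap_eq_smul_one, one_smul] at h2
  rw [← h2]
  simp only [TensorProduct.smul_tmul']

/-- `λ(h₍₁₎) h₍₂₎ = λ(h) 1`. -/
lemma IsRightIntegralDual.sum_smul (hlam : IsRightIntegralDual lam) (h : H) :
    ∑ i ∈ (ℛ k h).index, lam ((ℛ k h).left i) • (ℛ k h).right i = lam h • (1 : H) := by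
  rw [← sub_eq_zero, ← Module.forall_dual_apply_eq_zero_iff k]
  intro f
  have := congr($(hlam f) h)
  rw [(ℛ k h).convMul_apply] at this
  simp only [map_sub, map_sum, map_smul, sub_eq_zero, smul_eq_mul]
  refine this.trans ?_
  rw [mul_comm]
  rfl

variable (hΛ : IsLeftIntegral k Λ) (hlam : IsRightIntegralDual lam) (hlamΛ : lam Λ = 1)
include hΛ hlam hlamΛ

/-- Applying `λ ⊗ id` to `Λ₍₁₎ ⊗ h Λ₍₂₎ = S(h) Λ₍₁₎ ⊗ Λ₍₂₎` recovers `h` from `S(h)`. -/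
lemma antipode_injective : Function.Injective (antipode k : H →ₗ[k] H) := by
  rw [injective_iff_map_eq_zero]
  intro h hh
  have h1 := hΛ.one_tmul_mul_comul h
  rw [hh, TensorProduct.zero_tmul, zero_mul, ← (ℛ k Λ).eq, Finset.mul_sum] at h1
  have h2 := congr(TensorProduct.lift ((LinearMap.lsmul k H).comp lam) $h1)
  simp only [Algebra.TensorProduct.tmul_mul_tmul, one_mul, map_sum, TensorProduct.lift.tmul,
    LinearMap.comp_apply, LinearMap.lsmul_apply, map_zero, ← mul_smul_comm] at h2
  rw [← Finset.mul_sum, hlam.sum_smul, hlamΛ, one_smul, mul_one] at h2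
  exact h2

lemma antipode_bijective [Module.Finite k H] : Function.Bijective (antipode k : H →ₗ[k] H) :=
  have h := antipode_injective hΛ hlam hlamΛ
  ⟨h, LinearMap.injective_iff_surjective.1 h⟩

/-- The integrals make a finite-dimensional Hopf algebra a Frobenius algebra with dual bases
`Λ₍₁₎` and `S(Λ₍₂₎)`. -/
lemma isFrobeniusSystem [Module.Finite k H] : IsFrobeniusSystem lam (ℛ k Λ).index (ℛ k Λ).left
    (fun i => antipode k ((ℛ k Λ).right i)) where
  casimir h := by
    obtain ⟨h, rfl⟩ := (antipode_bijective hΛ hlam hlamΛ).2 h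
    have h1 := hΛ.one_tmul_mul_comul h
    rw [← (ℛ k Λ).eq, Finset.mul_sum, Finset.mul_sum] at h1
    have h2 := congr((antipode k).lTensor H $h1)
    simp only [Algebra.TensorProduct.tmul_mul_tmul, one_mul, map_sum, LinearMap.lTensor_tmul,
      antipode_mul_antidistrib] at h2
    exact h2.symm
  normalized := by
    have := congr(antipode k $(hlam.sum_smul Λ))
    simpa [hlamΛ] using this

/-- In a semisimple Hopf algebra a nonzero left integral is a right integral and has nonzero
counit. Indeed the augmentation ideal has a complement, which contains a left integral `t` with
`ε(t) = 1`; then `S(t)` is a right integral, so `t = S(t) t = S(t)` and `Λ = t Λ = ε(Λ) t`. -/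
lemma IsLeftIntegral.right_integral [Module.Finite k H] [IsSemisimpleRing H] :
    (∀ h : H, Λ * h = counit (R := k) h • Λ) ∧ counit (R := k) Λ ≠ 0 := by
  let I : Ideal H := RingHom.ker (Bialgebra.counitAlgHom k H)
  obtain ⟨f, hf, hIf⟩ := IsSemisimpleRing.ideal_eq_span_idempotent I
  have hfI : counit (R := k) f = 0 := (hIf ▸ Ideal.mem_span_singleton_self f : f ∈ I)
  let t : H := 1 - f
  have htε : counit (R := k) t = 1 := by simp [t, hfI]
  have htl : ∀ h : H, h * t = counit (R := k) h • t := fun h => by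
    have hI : h - algebraMap k H (counit (R := k) h) ∈ I := by
      change counit (R := k) _ = 0
      simp
    rw [hIf] at hI
    obtain ⟨a, ha⟩ := Ideal.mem_span_singleton'.1 hI
    rw [← sub_eq_zero, Algebra.smul_def, ← sub_mul, ← ha, mul_assoc, mul_sub, mul_one, hf.eq,
      sub_self, mul_zero]
  have hSr : ∀ h : H, antipode k t * h = counit (R := k) h • antipode k t := fun h => by
    obtain ⟨h, rfl⟩ := (antipode_bijective hΛ hlam hlamΛ).2 h
    rw [← antipode_mul_antidistrib, htl, map_smul, counit_antipode]
  have hSt : antipode k t = t := by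
    have h1 := hSr t
    rw [htl, counit_antipode, htε, one_smul, one_smul] at h1
    exact h1.symm
  have hΛt : Λ = counit (R := k) Λ • t := by
    have h1 := hSr Λ
    rw [hSt, hΛ, htε, one_smul] at h1
    exact h1
  have hne : counit (R := k) Λ ≠ 0 := fun h0 => by
    rw [h0, zero_smul] at hΛt
    rw [hΛt, map_zero] at hlamΛ
    exact zero_ne_one hlamΛ
  refine ⟨fun h => ?_, hne⟩
  rw [hΛt, smul_mul_assoc, ← hSt, hSr, hSt, smul_comm]

omit hΛ hlam hlamΛ in
lemma uElt_eq_sum (Λ : H) : uElt k Λ =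
    ∑ i ∈ (ℛ k Λ).index, antipode k ((ℛ k Λ).right i) * (ℛ k Λ).left i := by
  rw [uElt, ← (ℛ k Λ).eq]
  simp

end HopfAlgebras

/-! ### The element `u` and the distinguished group-like element -/

section ElementU

open HopfAlgebra Coalgebra

variable {k H : Type*} [Field k] [Ring H] [HopfAlgebra k H] [Module.Finite k H]
  {Λ : H} {lam : Module.Dual k H}
  (hΛ : IsLeftIntegral k Λ) (hlam : IsRightIntegralDual lam) (hlamΛ : lam Λ = 1)

include hlam hlamΛ in
/-- The square of the antipode is conjugation by `u`. -/
lemma antipode_antipode_mul_uElt (hΛ : IsLeftIntegral k Λ) [IsSemisimpleRing H] {u : Hˣ}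
    (hu : (u : H) = uElt k Λ) (h : H) :
    antipode k (antipode k h) * u = u * h := by
  have hF := isFrobeniusSystem hΛ hlam hlamΛ
  rw [uElt_eq_sum] at hu
  have h1 := comul_mul_tmul_one (hΛ.right_integral hlam hlamΛ).1 h
  rw [← (ℛ k Λ).eq, Finset.sum_mul, Finset.sum_mul] at h1
  have h2 := congr(TensorProduct.lift ((LinearMap.lsmul k H).comp lam)
    ((antipode k).lTensor H $h1))
  simp only [Algebra.TensorProduct.tmul_mul_tmul, mul_one, map_sum, LinearMap.lTensor_tmul,
    antipode_mul_antidistrib, TensorProduct.lift.tmul, LinearMap.comp_apply,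
    LinearMap.lsmul_apply, hF.apply_mul_comm hu _ h, ← mul_smul_comm] at h2
  rw [hF.sum_smul_right, ← Finset.mul_sum, hF.normalized, mul_one] at h2
  rw [← h2, Units.inv_mul_cancel_right]

include hlam hlamΛ in
/-- `S² = Ad u` gives `S(u) u S(h) = S(u) S³(h) u = S(S²(h) u) u = S(u h) u = S(h) S(u) u`. -/
lemma antipode_uElt_mul_mem_center (hΛ : IsLeftIntegral k Λ) [IsSemisimpleRing H] {u : Hˣ}
    (hu : (u : H) = uElt k Λ) :
    antipode k (u : H) * u ∈ Set.center H := by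
  refine Semigroup.mem_center_iff.2 fun h => ?_
  obtain ⟨h, rfl⟩ := (antipode_bijective hΛ hlam hlamΛ).2 h
  rw [mul_assoc, ← antipode_antipode_mul_uElt hlam hlamΛ hΛ hu, ← mul_assoc, ← mul_assoc,
    ← antipode_mul_antidistrib, ← antipode_mul_antidistrib,
    antipode_antipode_mul_uElt hlam hlamΛ hΛ hu]

omit [Module.Finite k H] in
/-- `χ(S(u)) = ε(Λ) dim V`, since `S(u) = S(Λ₍₁₎) S²(Λ₍₂₎)` has the same character value as
`S²(Λ₍₂₎) S(Λ₍₁₎) = S(Λ₍₁₎ S(Λ₍₂₎)) = ε(Λ)`. -/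
lemma character_antipode_uElt (Λ : H) (V : Type*) [AddCommGroup V] [Module k V] [Module H V]
    [IsScalarTower k H V] [Module.Finite k V] :
    character k H V (antipode k (uElt k Λ)) = counit (R := k) Λ * Module.finrank k V := by
  rw [uElt_eq_sum, map_sum, map_sum]
  simp_rw [antipode_mul_antidistrib]
  have h : ∀ i, character k H V (antipode k ((ℛ k Λ).left i) *
      antipode k (antipode k ((ℛ k Λ).right i))) =
      character k H V (antipode k ((ℛ k Λ).left i * antipode k ((ℛ k Λ).right i))) := fun i => by
    rw [character_mul_comm, antipode_mul_antidistrib]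
  simp_rw [h]
  rw [← map_sum, ← map_sum, sum_mul_antipode_eq_smul, map_smul, map_smul, antipode_one,
    character_one, smul_eq_mul]

include hΛ hlam hlamΛ

/-- The character of the regular representation is invariant under the antipode, which
intertwines left and right multiplication. -/
lemma character_antipode (h : H) :
    character k H H (antipode k h) = character k H H h := by
  let E := LinearEquiv.ofBijective _ (antipode_bijective hΛ hlam hlamΛ)
  have hE : E.conj (LinearMap.mulRight k h) = LinearMap.mulLeft k (antipode k h) :=
    LinearMap.ext fun x => by
      obtain ⟨x, rfl⟩ := E.surjective x
      rw [LinearEquiv.conj_apply_apply, E.symm_apply_apply]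
      exact antipode_mul_antidistrib x h
  rw [(isFrobeniusSystem hΛ hlam hlamΛ).character_eq_trace_mulRight h,
    ← LinearMap.trace_conj' _ E, hE]
  rfl

/-- `Λ₍₁₎ λ(Λ₍₂₎) = S(u⁻¹) u`: write `λ = χ_H(· u⁻¹)` and use `χ_H ∘ S = χ_H`. -/
lemma sum_apply_smul_eq {u : Hˣ} (hu : (u : H) = uElt k Λ) :
    ∑ i ∈ (ℛ k Λ).index, lam ((ℛ k Λ).right i) • (ℛ k Λ).left i =
      antipode k ((u⁻¹ : Hˣ) : H) * u := by
  have hF := isFrobeniusSystem hΛ hlam hlamΛ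
  rw [uElt_eq_sum] at hu
  have h1 : ∀ i, lam ((ℛ k Λ).right i) = character k H H
      (antipode k ((ℛ k Λ).right i) * antipode k ((u⁻¹ : Hˣ) : H)) := fun i => by
    rw [hF.apply_eq_character_mul_inv hu, ← character_antipode hΛ hlam hlamΛ,
      antipode_mul_antidistrib, character_mul_comm]
  have h2 := hF.casimir_apply ((LinearMap.lsmul k H).flip.compl₂ (character k H H))
    (antipode k ((u⁻¹ : Hˣ) : H))
  simp only [LinearMap.compl₂_apply, LinearMap.flip_apply] at h2
  simp_rw [h1]
  refine h2.symm.trans ?_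
  simp only [LinearMap.lsmul_apply, hF.character_eq_mul_right, ← hu]
  simp_rw [← mul_smul_comm, ← Finset.mul_sum]
  congr 1
  exact hF.sum_smul_left _

/-- Right integrals of the dual are unique up to scalars. -/
lemma rightIntegralDual_eq_smul {lam' : Module.Dual k H} (hlam' : IsRightIntegralDual lam') :
    lam' = lam' Λ • lam := by
  have hF := isFrobeniusSystem hΛ hlam hlamΛ
  have h1 := congr(antipode k $(hlam'.sum_smul Λ))
  simp only [map_sum, map_smul, antipode_one] at h1
  refine LinearMap.ext fun h => ?_
  conv_lhs => rw [← hF.sum_smul_left h]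
  have h2 := congr(lam ($h1 * h))
  simp only [Finset.sum_mul, smul_mul_assoc, one_mul, map_sum, map_smul, smul_eq_mul] at h2
  simp only [map_sum, map_smul, LinearMap.smul_apply, smul_eq_mul, ← h2]
  exact Finset.sum_congr rfl fun i _ => mul_comm _ _

/-- `f λ` is again a right integral, hence a multiple of `λ`; evaluating at `Λ` gives the factor. -/
lemma toConv_mul_toConv (f : Module.Dual k H) :
    WithConv.toConv f * WithConv.toConv lam =
      f (∑ i ∈ (ℛ k Λ).index, lam ((ℛ k Λ).right i) • (ℛ k Λ).left i) • WithConv.toConv lam := by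
  have hint : IsRightIntegralDual (WithConv.toConv f * WithConv.toConv lam).ofConv := fun f' => by
    rw [WithConv.toConv_ofConv, mul_assoc, hlam, mul_smul_comm]
  have h1 := rightIntegralDual_eq_smul hΛ hlam hlamΛ hint
  have h2 : (WithConv.toConv f * WithConv.toConv lam).ofConv Λ =
      f (∑ i ∈ (ℛ k Λ).index, lam ((ℛ k Λ).right i) • (ℛ k Λ).left i) := by
    refine ((ℛ k Λ).convMul_apply (WithConv.toConv f) (WithConv.toConv lam)).trans ?_
    simp only [map_sum, map_smul, smul_eq_mul]
    exact Finset.sum_congr rfl fun i _ => mul_comm _ _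
  rw [h2] at h1
  exact congr(WithConv.toConv $h1)

omit [Module.Finite k H] hΛ hlam in
/-- An element `g` with `f λ = f(g) λ` for all `f` in the dual is group-like. -/
lemma isGroupLikeElem_of_mul_integral {g : H}
    (hg : ∀ f : Module.Dual k H,
      WithConv.toConv f * WithConv.toConv lam = f g • WithConv.toConv lam) :
    IsGroupLikeElem k g := by
  -- The map `K h = h₍₁₎ λ(h₍₂₎)` equals `h ↦ λ(h) g`. Coassociativity gives `Δ ∘ K = (id ⊗ K) ∘ Δ`,
  -- which at `Λ` reads `Δ(g) = K(Λ) ⊗ g = g ⊗ g`.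
  let K : H →ₗ[k] H := (TensorProduct.rid k H).toLinearMap ∘ₗ lam.lTensor H ∘ₗ comul
  have hK : ∀ h, K h = lam h • g := fun h => by
    rw [← sub_eq_zero, ← Module.forall_dual_apply_eq_zero_iff k]
    intro f
    have h1 := congr($(hg f) h)
    rw [(ℛ k h).convMul_apply] at h1
    have h2 : K h = ∑ i ∈ (ℛ k h).index, lam ((ℛ k h).right i) • (ℛ k h).left i := by
      simp only [K, LinearMap.comp_apply]
      rw [← (ℛ k h).eq]
      simp
    rw [map_sub, sub_eq_zero, h2, map_smul, smul_eq_mul, mul_comm]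
    refine Eq.trans ?_ h1
    simp only [map_sum, map_smul, smul_eq_mul]
    exact Finset.sum_congr rfl fun i _ => mul_comm _ _
  have hKΛ : K Λ = g := by rw [hK, hlamΛ, one_smul]
  have hcomul : ∀ h, comul (K h) = K.lTensor H (comul h) := fun h => by
    have h1 : comul ∘ₗ (TensorProduct.rid k H).toLinearMap ∘ₗ lam.lTensor H =
        (TensorProduct.rid k H).toLinearMap.lTensor H ∘ₗ (lam.lTensor H).lTensor H ∘ₗ
          (TensorProduct.assoc k H H H).toLinearMap ∘ₗ comul.rTensor H := by
      ext a b
      simp only [TensorProduct.AlgebraTensorModule.curry_apply, TensorProduct.curry_apply,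
        LinearMap.restrictScalars_self, LinearMap.comp_apply, LinearMap.lTensor_tmul,
        LinearMap.rTensor_tmul, LinearEquiv.coe_coe, TensorProduct.rid_tmul, map_smul]
      generalize (comul a : H ⊗[k] H) = t
      induction t with
      | zero => simp
      | add s t hs ht => simp only [smul_add, hs, ht, TensorProduct.add_tmul, map_add]
      | tmul a b => simp
    have h2 := congr($h1 (comul h))
    simp only [LinearMap.comp_apply, LinearEquiv.coe_coe, coassoc_apply] at h2
    simp only [K, LinearMap.lTensor_comp, LinearMap.comp_apply, LinearEquiv.coe_coe]
    exact h2
  refine ⟨?_, ?_⟩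
  · have h1 := congr($(hg counit) Λ)
    have h2 : WithConv.toConv (counit : Module.Dual k H) = 1 := rfl
    rw [h2, one_mul] at h1
    have h3 : lam Λ = counit (R := k) g * lam Λ := h1
    rwa [hlamΛ, mul_one, eq_comm] at h3
  · conv_lhs => rw [← hKΛ]
    rw [hcomul]
    have h1 : K.lTensor H = ((LinearMap.toSpanSingleton k H g) ∘ₗ lam).lTensor H := by
      congr 1
      exact LinearMap.ext hK
    rw [h1, ← hKΛ]
    simp only [K, LinearMap.comp_apply, ← (ℛ k Λ).eq]
    simp [TensorProduct.sum_tmul, TensorProduct.smul_tmul]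

lemma isDistinguishedGroupLike_iff {u : Hˣ} (hu : (u : H) = uElt k Λ) (g : H) :
    IsDistinguishedGroupLike k g ↔ g = antipode k ((u⁻¹ : Hˣ) : H) * u := by
  have hmul := toConv_mul_toConv hΛ hlam hlamΛ
  rw [sum_apply_smul_eq hΛ hlam hlamΛ hu] at hmul
  constructor
  · intro hg
    rw [← sub_eq_zero, ← Module.forall_dual_apply_eq_zero_iff k]
    intro f
    have h1 := congr(WithConv.ofConv $((hg.mul_integral lam hlam f).symm.trans (hmul f)) Λ)
    have h2 : f g * lam Λ = f (antipode k ((u⁻¹ : Hˣ) : H) * u) * lam Λ := h1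
    rw [map_sub, sub_eq_zero]
    simpa [hlamΛ] using h2
  · rintro rfl
    refine ⟨isGroupLikeElem_of_mul_integral hlamΛ hmul, fun lam' hlam' f => ?_⟩
    have h1 : WithConv.toConv lam' = lam' Λ • WithConv.toConv lam :=
      congr(WithConv.toConv $(rightIntegralDual_eq_smul hΛ hlam hlamΛ hlam'))
    rw [h1, mul_smul_comm, hmul, smul_comm]

end ElementU

end SemisimpleHopf

/-! ### The values of `λ` on the blocks and the square `u S(u)` -/

theorem mainTheorem8 {k H : Type*} [Field k] [IsAlgClosed k] [Ring H] [HopfAlgebra k H]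
    [Module.Finite k H] [IsSemisimpleRing H]
    (p : ℕ) [CharP k p] (hp : p = 0 ∨ Module.finrank k H < p ^ 2)
    (Λ : H) (hΛ : SemisimpleHopf.IsLeftIntegral k Λ)
    (lam : Module.Dual k H) (hlam : SemisimpleHopf.IsRightIntegralDual lam)
    (hlamΛ : lam Λ = 1)
    {I : Type*} [Fintype I] (V : I → Type*)
    [∀ i, AddCommGroup (V i)] [∀ i, Module k (V i)] [∀ i, Module H (V i)]
    [∀ i, IsScalarTower k H (V i)]
    (hV : SemisimpleHopf.IsCompleteSimpleFamily H V)
    (e : I → H) (he : ∀ i, SemisimpleHopf.IsCentralPrimitiveIdempotent (e i))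
    (heV : ∀ i, ∀ v : V i, e i • v = v) :
    ∃ u : Hˣ, (u : H) = SemisimpleHopf.uElt k Λ ∧
      -- (1) `u = χ_H(Λ₍₁₎) S(Λ₍₂₎)`
      (u : H) = TensorProduct.lid k H
        (TensorProduct.map (SemisimpleHopf.character k H H) (HopfAlgebra.antipode k)
          (Coalgebra.comul (R := k) Λ)) ∧
      -- (2) `Λ₍₁₎ u⁻¹ S(Λ₍₂₎) = 1`
      LinearMap.mul' k H
        (TensorProduct.map LinearMap.id
          (LinearMap.mulLeft k ((u⁻¹ : Hˣ) : H) ∘ₗ HopfAlgebra.antipode k)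
          (Coalgebra.comul (R := k) Λ)) = 1 ∧
      -- (3) `λ(e_i) = dim(V_i) χ_i(u⁻¹)`
      (∀ i, lam (e i) = (Module.finrank k (V i) : k) *
        SemisimpleHopf.character k H (V i) ((u⁻¹ : Hˣ) : H)) ∧
      -- (4) `u S(u) = S(u) u = ε(Λ) ∑ i, dim(V_i)² / λ(e_i) e_i`, with nonzero denominators
      (∀ i, lam (e i) ≠ 0) ∧
      (u : H) * HopfAlgebra.antipode k (u : H) = HopfAlgebra.antipode k (u : H) * (u : H) ∧
      HopfAlgebra.antipode k (u : H) * (u : H) = Coalgebra.counit (R := k) Λ •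
        ∑ i, ((Module.finrank k (V i) : k) ^ 2 / lam (e i)) • e i ∧
      -- (5) `S(u⁻¹) u = u S(u⁻¹)` is the distinguished group-like element
      HopfAlgebra.antipode k ((u⁻¹ : Hˣ) : H) * (u : H) =
        (u : H) * HopfAlgebra.antipode k ((u⁻¹ : Hˣ) : H) ∧
      ∀ g : H, SemisimpleHopf.IsDistinguishedGroupLike k g ↔
        g = HopfAlgebra.antipode k ((u⁻¹ : Hˣ) : H) * (u : H) := by
  classical
  have hF := SemisimpleHopf.isFrobeniusSystem hΛ hlam hlamΛ
  have huE := SemisimpleHopf.uElt_eq_sum (k := k) Λ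
  obtain ⟨u, hu⟩ : IsUnit (SemisimpleHopf.uElt k Λ) := by
    rw [huE]
    exact hF.isUnit_sum_mul p hp
  have hu' := hu.trans huE
  have hε := (hΛ.right_integral hlam hlamΛ).2
  have hsimple := hV.simple
  have hfin := fun i => SemisimpleHopf.finite_of_isSimpleModule k H (V i)
  have hdim : ∀ i, (Module.finrank k (V i) : k) ≠ 0 := fun i =>
    SemisimpleHopf.finrank_cast_ne_zero (A := H) k p hp
  have h3 : ∀ i, lam (e i) = (Module.finrank k (V i) : k) *
      SemisimpleHopf.character k H (V i) ((u⁻¹ : Hˣ) : H) := fun i => by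
    rw [hF.apply_eq_character_mul_inv hu', (he i).character_mul (heV i)]
  have hc := SemisimpleHopf.antipode_uElt_mul_mem_center hlam hlamΛ hΛ hu
  choose c hcV using fun i => SemisimpleHopf.exists_smul_eq_of_mem_center k (V i) hc
  -- Evaluate `χ_i` on `S(u) = (S(u) u) u⁻¹`.
  have hcχ : ∀ i, c i * SemisimpleHopf.character k H (V i) ((u⁻¹ : Hˣ) : H) =
      Coalgebra.counit (R := k) Λ * Module.finrank k (V i) := fun i => by
    rw [← SemisimpleHopf.character_mul_of_smul_eq (hcV i), Units.mul_inv_cancel_right, hu,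
      SemisimpleHopf.character_antipode_uElt]
  have hlame : ∀ i, lam (e i) ≠ 0 := fun i => by
    rw [h3]
    exact mul_ne_zero (hdim i) (right_ne_zero_of_mul (hcχ i ▸ mul_ne_zero hε (hdim i)))
  -- `S(u) u` commutes with `u`.
  have hcomm : (u : H) * HopfAlgebra.antipode k (u : H) =
      HopfAlgebra.antipode k (u : H) * (u : H) := by
    refine u.isUnit.mul_right_cancel ?_
    rw [mul_assoc, (Set.mem_center_iff.1 hc).comm u |>.eq]
  have hinv : HopfAlgebra.antipode k ((u⁻¹ : Hˣ) : H) * HopfAlgebra.antipode k (u : H) = 1 := by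
    rw [← HopfAlgebra.antipode_mul_antidistrib, Units.mul_inv, HopfAlgebra.antipode_one]
  have hinv' : HopfAlgebra.antipode k (u : H) * HopfAlgebra.antipode k ((u⁻¹ : Hˣ) : H) = 1 := by
    rw [← HopfAlgebra.antipode_mul_antidistrib, Units.inv_mul, HopfAlgebra.antipode_one]
  refine ⟨u, hu, ?_, ?_, h3, hlame, hcomm, ?_, ?_,
    SemisimpleHopf.isDistinguishedGroupLike_iff hΛ hlam hlamΛ hu⟩
  · rw [hu', ← hF.sum_character_smul]
    conv_rhs => rw [← (Coalgebra.Repr.arbitrary k Λ).eq]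
    simp
  · rw [← hF.sum_mul_inv_mul hu']
    conv_lhs => rw [← (Coalgebra.Repr.arbitrary k Λ).eq]
    simp [mul_assoc]
  · rw [← sub_eq_zero]
    refine SemisimpleHopf.eq_zero_of_smul_eq_zero hV fun j v => ?_
    have hej : ∀ i, e i • v = if i = j then v else 0 := fun i => by
      split_ifs with h
      · subst h
        exact heV i v
      · exact (he i).smul_eq_zero (heV i) ⟨fun φ => h (hV.eq_of_equiv i j ⟨φ⟩)⟩ v
    rw [sub_smul, hcV, smul_assoc, Finset.sum_smul]
    simp only [smul_assoc, hej, smul_ite, smul_zero, Finset.sum_ite_eq', Finset.mem_univ, if_true]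
    rw [smul_smul, ← sub_smul]
    have hcj : c j = Coalgebra.counit (R := k) Λ *
        ((Module.finrank k (V j) : k) ^ 2 / lam (e j)) := by
      rw [mul_div_assoc', eq_div_iff (hlame j), h3]
      linear_combination (Module.finrank k (V j) : k) * hcχ j
    rw [hcj, sub_self, zero_smul]
  · calc HopfAlgebra.antipode k ((u⁻¹ : Hˣ) : H) * (u : H)
        = HopfAlgebra.antipode k ((u⁻¹ : Hˣ) : H) * ((u : H) * HopfAlgebra.antipode k (u : H)) *
            HopfAlgebra.antipode k ((u⁻¹ : Hˣ) : H) := by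
          rw [mul_assoc, mul_assoc, hinv', mul_one]
      _ = (u : H) * HopfAlgebra.antipode k ((u⁻¹ : Hˣ) : H) := by
          rw [hcomm, ← mul_assoc, hinv, one_mul]
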